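/- Let $H_n$ be the classical (physicists') Hermite polynomials, $H_0=1$, $H_{n+1}=2xH_n-H_n'$, and let $\operatorname{Wr}[f_1,\dots,f_n]=\det\big(f_j^{(i-1)}\big)_{i,j=1}^n$ be the Wronskian determinant (equal to $1$ for $n=0$). Let $\lambda=(\lambda_1,\dots,\lambda_\ell)$, $\ell\ge 0$, be a partition of length $\ell$, that is, integers $0\le\lambda_1\le\dots\le\lambda_\ell$ (initial zeros are allowed), and let $\lambda^2=(\lambda_1,\lambda_1,\dots,\lambda_\ell,\lambda_\ell)$ be the double partition, of length $2\ell$. Let $k_i=(\lambda^2)_i+i-1$, $1\le i\le 2\ell$, be its gap sequence, so that $k_1<k_2<\dots<k_{2\ell}$, and put $$H_{\lambda^2}=\operatorname{Wr}[H_{k_1},\dots,H_{k_{2\ell}}],\qquad p_{\lambda^2}(x)=\prod_{i=1}^{2\ell}(x-k_i).$$ The $X_\lambda$-Hermite polynomials are $$H^{(\lambda)}_j=\operatorname{Wr}[H_{k_1},\dots,H_{k_{2\ell}},H_j],\qquad j\in\mathbb N\setminus\{k_1,\dots,k_{2\ell}\},\quad \mathbb N=\{0,1,2,\dots\}.$$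 **Proposition (orthogonality).** The polynomial $H_{\lambda^2}$ has no real zeros, so that the weight $W_{\lambda^2}(x)=e^{-x^2}/\big(H_{\lambda^2}(x)\big)^2$ is regular and positive on $\mathbb R$. For all $i,j\in\mathbb N\setminus\{k_1,\dots,k_{2\ell}\}$ the function $H^{(\lambda)}_iH^{(\lambda)}_jW_{\lambda^2}$ is integrable on $\mathbb R$ and $$\int_{-\infty}^{\infty}H^{(\lambda)}_i(x)\,H^{(\lambda)}_j(x)\,W_{\lambda^2}(x)\,dx=\delta_{i,j}\,\sqrt{\pi}\;2^{\,j+2\ell}\,j!\;p_{\lambda^2}(j).$$ -/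

import Mathlib

open Polynomial MeasureTheory

noncomputable section

namespace XHermite

/-- The classical (physicists') Hermite polynomials: `H 0 = 1`, `H (n+1) = 2 x H n - (H n)'`;
thus `H n` has degree `n` and leading coefficient `2 ^ n`. -/
def hermiteH : ℕ → ℝ[X]
  | 0 => 1
  | n + 1 => C 2 * X * hermiteH n - derivative (hermiteH n)

/-- The Wronskian determinant of the polynomials `f 0, …, f (n-1)`: row `i` holds their `i`-th
derivatives. The empty Wronskian is `1`. -/
def wronskianDet {n : ℕ} (f : Fin n → ℝ[X]) : ℝ[X] :=
  Matrix.det (Matrix.of fun i j : Fin n => derivative^[(i : ℕ)] (f j))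

/-- The gap sequence of a partition `lam` (with parts in non-decreasing order). With indices
starting at `0` this is `k_i = lam_i + i`. -/
def gapSeq {n : ℕ} (lam : Fin n → ℕ) (i : Fin n) : ℕ := lam i + i

/-- The double partition `(lam_1, lam_1, lam_2, lam_2, …, lam_l, lam_l)`. -/
def double {l : ℕ} (lam : Fin l → ℕ) (i : Fin (2 * l)) : ℕ :=
  lam ⟨(i : ℕ) / 2, by omega⟩

/-- `H_lam = Wr[H_{k_1}, …, H_{k_n}]`. -/
def hermiteWr {n : ℕ} (lam : Fin n → ℕ) : ℝ[X] :=
  wronskianDet fun i => hermiteH (gapSeq lam i)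

/-- `H_{lam, j} = Wr[H_{k_1}, …, H_{k_n}, H_j]`. -/
def hermiteWrAdd {n : ℕ} (lam : Fin n → ℕ) (j : ℕ) : ℝ[X] :=
  wronskianDet (Fin.snoc (α := fun _ => ℝ[X]) (fun i => hermiteH (gapSeq lam i)) (hermiteH j))

/-- The indices `j` of the exceptional Hermite polynomials `H^{(lam)}_j`: the natural numbers that
do not belong to the gap sequence of the double partition. -/
def indexSet {l : ℕ} (lam : Fin l → ℕ) : Set ℕ := (Set.range (gapSeq (double lam)))ᶜ

/-- The exceptional Hermite polynomial `H^{(lam)}_j` (meant for `j ∈ indexSet lam`). -/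
def xHermite {l : ℕ} (lam : Fin l → ℕ) (j : ℕ) : ℝ[X] := hermiteWrAdd (double lam) j

/-- `p_lam(x) = (x - k_1) ⋯ (x - k_n)`. -/
def gapPoly {n : ℕ} (lam : Fin n → ℕ) : ℝ[X] :=
  ∏ i, (X - C (gapSeq lam i : ℝ))

/-- `W_lam(x) = exp(-x²) / H_lam(x)²`. -/
def weight {n : ℕ} (lam : Fin n → ℕ) (x : ℝ) : ℝ :=
  Real.exp (-x ^ 2) / ((hermiteWr lam).eval x) ^ 2

end XHermite

end

/-!
Two arguments carry the proof; the second uses the first only to see that its weights are regular.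

**Absence of real zeros** (`seqWr_eval_ne_zero_of_pairing`). Let `A = x d/dx - (1/2) d²/dx²`,
so that `A H_n = n H_n`. The gap sequence consists of pairs `m_i, m_i + 1`; put `P = ∏ (X - m_i)`
and `Q = ∏ (X - m_i - 1)`. If the Wronskian vanishes at `a`, some combination `F ≠ 0` of the `H_k`,
with `k` in the gap sequence, vanishes at `a` to order `2l`. Integrating over `(-∞, a]` against
`exp (-x²)`, there are no boundary terms (`halfInt_aeval_hermiteOp_mul`), so
`⟨P(A) F, Q(A) F⟩ = ⟨F, (P Q)(A) F⟩ = 0` and `⟨P(A) F, H_n⟩ = P(n) ⟨F, H_n⟩`, and likewise for `Q`.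
By Parseval's identity on the half-line (`hasSum_halfInt_mul_halfInt`) the sum of
`P(n) Q(n) ⟨F, H_n⟩² / ‖H_n‖²` vanishes. As `P(n) Q(n) > 0` off the gap sequence, only finitely many
`⟨F, H_n⟩` are nonzero, so `F` cut off at `a` is almost everywhere a polynomial, and `F = 0`.
Completeness of the Hermite functions is proved through characteristic functions.

**Orthogonality** (`integral_seqWr_double`). Write `W = Wr[H_k]`, `W_i = Wr[H_k, H_i]` and
`w_ij = Wr[H_k, H_i, H_j]` for a sequence `k`. The Desnanot–Jacobi identity
`w_ij W = W_i W_j' - W_i' W_j` and induction on the length of `k` give Crum's theorem in the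
bilinear form `(w_ij / W)' - 2x w_ij / W = 2 (i - j) W_i W_j / W²` (`isDarboux`). It follows that
adjoining two entries `u, v` changes `4 (j - v) (i - u) W_i W_j exp (-x²) / W²` into the
corresponding expression for the longer sequence up to the derivative of a multiple of
`w_ui w_vj exp (-x²) / (W w_uv)` (`IsDarboux.two_step`). The denominator has no real zeros when both
sequences are gap sequences of double partitions, so the integral of this derivative is zero, and
induction on `l` reduces the formula to the orthogonality of the `H_n`.
-/

noncomputable section

namespace XHermite

/-! ### The Desnanot–Jacobi identity for Wronskians -/

/-- Desnanot–Jacobi identity for a square block `A` bordered by two rows and two columns. Over the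
fraction field, every bordered determinant is `det A` times a minor of the Schur complement
of `A`. -/
theorem _root_.Matrix.det_fromBlocks_mul_det_eq_bordered {R m : Type*} [CommRing R] [IsDomain R]
    [Fintype m] [DecidableEq m] (A : Matrix m m R) (B : Matrix m (Fin 2) R)
    (C : Matrix (Fin 2) m R) (D : Matrix (Fin 2) (Fin 2) R) (hA : A.det ≠ 0) :
    let bord : Fin 2 → Fin 2 → R := fun p q =>
      (Matrix.fromBlocks A (B.submatrix id fun _ : Fin 1 => q)
        (C.submatrix (fun _ : Fin 1 => p) id)
        (D.submatrix (fun _ : Fin 1 => p) fun _ : Fin 1 => q)).det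
    (Matrix.fromBlocks A B C D).det * A.det = bord 0 0 * bord 1 1 - bord 0 1 * bord 1 0 := by
  intro bord
  let K := FractionRing R
  let φ : R →+* K := algebraMap R K
  have hφ : Function.Injective φ := IsFractionRing.injective R K
  apply hφ
  have hdet : (A.map φ).det ≠ 0 := by
    change (φ.mapMatrix A).det ≠ 0
    rw [← RingHom.map_det]
    exact fun h => hA (hφ (by rw [h, map_zero]))
  let _ : Invertible (A.map φ) := Matrix.invertibleOfIsUnitDet _ (isUnit_iff_ne_zero.mpr hdet)
  set S : Matrix (Fin 2) (Fin 2) K := D.map φ - C.map φ * ⅟(A.map φ) * B.map φ with hS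
  have hA' : φ A.det = (A.map φ).det := RingHom.map_det φ A
  have hbord : ∀ p q, φ (bord p q) = (A.map φ).det * S p q := by
    intro p q
    rw [RingHom.map_det, RingHom.mapMatrix_apply, Matrix.fromBlocks_map, Matrix.det_fromBlocks₁₁,
      Matrix.det_fin_one]
    rfl
  simp only [map_mul, map_sub, hbord, hA']
  rw [RingHom.map_det, RingHom.mapMatrix_apply, Matrix.fromBlocks_map, Matrix.det_fromBlocks₁₁,
    ← hS, Matrix.det_fin_two]
  ring

theorem _root_.Polynomial.derivative_det {R n : Type*} [CommRing R] [Fintype n] [DecidableEq n]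
    (M : Matrix n n R[X]) :
    derivative M.det = ∑ i, (M.updateRow i fun j => derivative (M i j)).det := by
  simp_rw [← Matrix.det_transpose M, ← Matrix.det_transpose (M.updateRow _ _), Matrix.det_apply,
    derivative_sum]
  rw [Finset.sum_comm]
  refine Finset.sum_congr rfl fun σ _ => ?_
  rw [← Finset.smul_sum, derivative_smul, derivative_prod_finset]
  congr 1
  refine Finset.sum_congr rfl fun i _ => ?_
  rw [← Finset.mul_prod_erase _ _ (Finset.mem_univ i), mul_comm]
  congr 1
  · simp
  · refine Finset.prod_congr rfl fun j hj => ?_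
    simp [Matrix.updateRow_ne (Finset.ne_of_mem_erase hj)]

/-- The determinant of the derivatives of orders `r 0, …, r (n-1)` of `f 0, …, f (n-1)`. -/
def genWronskian {n : ℕ} (r : Fin n → ℕ) (f : Fin n → ℝ[X]) : ℝ[X] :=
  Matrix.det (Matrix.of fun i j : Fin n => derivative^[r i] (f j))

/-- The sequence `f` followed by `g`. -/
abbrev snocP {n : ℕ} (f : Fin n → ℝ[X]) (g : ℝ[X]) : Fin (n + 1) → ℝ[X] :=
  Fin.snoc (α := fun _ => ℝ[X]) f g

/-- Only the last row contributes to the derivative of a Wronskian: differentiating any other row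
repeats the row below it. -/
theorem derivative_wronskianDet {n : ℕ} (f : Fin (n + 1) → ℝ[X]) :
    derivative (wronskianDet f) =
      genWronskian (Fin.snoc (α := fun _ => ℕ) (fun i : Fin n => (i : ℕ)) (n + 1)) f := by
  rw [wronskianDet, derivative_det, Fin.sum_univ_castSucc, Finset.sum_eq_zero, zero_add]
  · rw [genWronskian]
    congr 1
    ext1 i j
    induction i using Fin.lastCases with
    | last => simp [Function.iterate_succ_apply']
    | cast i => simp
  · intro i _
    refine Matrix.det_zero_of_row_eq (i := i.castSucc) (j := i.succ) (Fin.castSucc_lt_succ).ne ?_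
    ext1 j
    rw [Matrix.updateRow_self, Matrix.updateRow_ne (Fin.castSucc_lt_succ).ne']
    simp [Function.iterate_succ_apply']

theorem snoc_castAdd_one {α : Type*} {n : ℕ} (f : Fin n → α) (a : α) (j : Fin n) :
    Fin.snoc (α := fun _ => α) f a (Fin.castAdd 1 j) = f j :=
  Fin.snoc_castSucc (α := fun _ => α) a f j

theorem snoc_natAdd_zero {α : Type*} {n : ℕ} (f : Fin n → α) (a : α) :
    Fin.snoc (α := fun _ => α) f a (Fin.natAdd n (0 : Fin 1)) = a :=
  Fin.snoc_last (α := fun _ => α) a f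

theorem snoc_snoc_natAdd_zero {α : Type*} {n : ℕ} (f : Fin n → α) (a b : α) :
    Fin.snoc (α := fun _ => α) (Fin.snoc (α := fun _ => α) f a : Fin (n + 1) → α) b
      (Fin.natAdd n (0 : Fin 2)) = a :=
  (Fin.snoc_castSucc (α := fun _ => α) b _ (Fin.last n)).trans
    (Fin.snoc_last (α := fun _ => α) a f)

theorem snoc_snoc_natAdd_one {α : Type*} {n : ℕ} (f : Fin n → α) (a b : α) :
    Fin.snoc (α := fun _ => α) (Fin.snoc (α := fun _ => α) f a : Fin (n + 1) → α) b
      (Fin.natAdd n (1 : Fin 2)) = b :=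
  Fin.snoc_last (α := fun _ => α) b _

/-- The Desnanot–Jacobi identity for Wronskians,
`Wr[f, a, b] Wr[f] = Wr[Wr[f, a], Wr[f, b]]`. -/
theorem wronskianDet_snoc_snoc_mul {n : ℕ} (f : Fin n → ℝ[X]) (a b : ℝ[X])
    (hf : wronskianDet f ≠ 0) :
    wronskianDet (snocP (snocP f a) b) * wronskianDet f =
      wronskianDet (snocP f a) * derivative (wronskianDet (snocP f b)) -
        derivative (wronskianDet (snocP f a)) * wronskianDet (snocP f b) := by
  have key := Matrix.det_fromBlocks_mul_det_eq_bordered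
    (Matrix.of fun i j : Fin n => derivative^[(i : ℕ)] (f j))
    (Matrix.of fun (i : Fin n) (q : Fin 2) => derivative^[(i : ℕ)] (![a, b] q))
    (Matrix.of fun (p : Fin 2) (j : Fin n) => derivative^[n + p] (f j))
    (Matrix.of fun (p : Fin 2) (q : Fin 2) => derivative^[n + p] (![a, b] q)) hf
  have hbord : ∀ p q : Fin 2,
      genWronskian (Fin.snoc (α := fun _ => ℕ) (fun i : Fin n => (i : ℕ)) (n + p))
        (snocP f (![a, b] q)) =
      (Matrix.fromBlocks (Matrix.of fun i j : Fin n => derivative^[(i : ℕ)] (f j))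
        ((Matrix.of fun (i : Fin n) (q : Fin 2) =>
          derivative^[(i : ℕ)] (![a, b] q)).submatrix id fun _ : Fin 1 => q)
        ((Matrix.of fun (p : Fin 2) (j : Fin n) =>
          derivative^[n + p] (f j)).submatrix (fun _ : Fin 1 => p) id)
        ((Matrix.of fun (p : Fin 2) (q : Fin 2) =>
          derivative^[n + p] (![a, b] q)).submatrix
            (fun _ : Fin 1 => p) fun _ : Fin 1 => q)).det := by
    intro p q
    rw [genWronskian, ← Matrix.det_submatrix_equiv_self (finSumFinEquiv (m := n) (n := 1))]
    congr 1
    ext1 (i | i) (j | j)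
    · simp [snoc_castAdd_one]
    · obtain rfl := Subsingleton.elim j 0
      simp [snoc_castAdd_one, snoc_natAdd_zero]
    · obtain rfl := Subsingleton.elim i 0
      simp [snoc_castAdd_one, snoc_natAdd_zero]
    · obtain rfl := Subsingleton.elim i 0
      obtain rfl := Subsingleton.elim j 0
      simp [snoc_natAdd_zero]
  have hfull : wronskianDet (snocP (snocP f a) b) =
      (Matrix.fromBlocks (Matrix.of fun i j : Fin n => derivative^[(i : ℕ)] (f j))
        (Matrix.of fun (i : Fin n) (q : Fin 2) => derivative^[(i : ℕ)] (![a, b] q))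
        (Matrix.of fun (p : Fin 2) (j : Fin n) => derivative^[n + p] (f j))
        (Matrix.of fun (p : Fin 2) (q : Fin 2) => derivative^[n + p] (![a, b] q))).det := by
    rw [wronskianDet, ← Matrix.det_submatrix_equiv_self (finSumFinEquiv (m := n) (n := 2))]
    congr 1
    ext1 (i | i) (j | j)
    · simp [snoc_castAdd_one]
    · fin_cases j <;> simp [snoc_snoc_natAdd_zero, snoc_snoc_natAdd_one]
    · fin_cases i <;> simp [snoc_castAdd_one]
    · fin_cases i <;> fin_cases j <;> simp [snoc_snoc_natAdd_zero, snoc_snoc_natAdd_one]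
  have hrow : ∀ q : Fin 2, genWronskian
      (Fin.snoc (α := fun _ => ℕ) (fun i : Fin n => (i : ℕ)) (n + ((0 : Fin 2) : ℕ)))
        (snocP f (![a, b] q)) = wronskianDet (snocP f (![a, b] q)) := by
    intro q
    rw [genWronskian, wronskianDet]
    congr 1
    ext1 i j
    induction i using Fin.lastCases <;> simp
  have h0 := fun q => (hrow q).symm.trans (hbord 0 q)
  have h1 := fun q => (derivative_wronskianDet (snocP f (![a, b] q))).trans (hbord 1 q)
  rw [hfull]
  refine key.trans ?_
  dsimp only
  rw [← h0, ← h0, ← h1, ← h1]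
  simp only [Matrix.cons_val_zero, Matrix.cons_val_one]
  ring

/-! ### Crum's theorem for Hermite polynomials -/

theorem hermiteH_succ (n : ℕ) :
    hermiteH (n + 1) = 2 * X * hermiteH n - derivative (hermiteH n) := by
  rw [hermiteH]
  rfl

/-- The Hermite differential equation. -/
theorem derivative_derivative_hermiteH (n : ℕ) :
    derivative (derivative (hermiteH n)) =
      2 * X * derivative (hermiteH n) - 2 * (n : ℝ[X]) * hermiteH n := by
  induction n with
  | zero => simp [hermiteH]
  | succ n ih =>
    have h1 : derivative (hermiteH (n + 1)) = 2 * (n + 1) * hermiteH n := by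
      rw [hermiteH_succ]
      simp only [derivative_sub, derivative_mul, ih, derivative_X, derivative_ofNat]
      ring
    rw [h1]
    have h2 : derivative ((2 * (n + 1) : ℝ[X]) * hermiteH n) =
        2 * (n + 1) * derivative (hermiteH n) := by
      simp [derivative_mul]
    rw [h2, hermiteH_succ]
    push_cast
    ring

theorem derivative_hermiteH_succ (n : ℕ) :
    derivative (hermiteH (n + 1)) = 2 * (n + 1) * hermiteH n := by
  rw [hermiteH_succ]
  simp only [derivative_sub, derivative_mul, derivative_derivative_hermiteH, derivative_X,
    derivative_ofNat]
  ring

theorem hermiteH_ne_zero (n : ℕ) : hermiteH n ≠ 0 := by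
  induction n with
  | zero => simp [hermiteH]
  | succ n ih =>
    intro h
    have h1 := derivative_hermiteH_succ n
    rw [h, derivative_zero, eq_comm, mul_eq_zero] at h1
    refine h1.elim (fun h2 => ?_) ih
    have : ((2 * (n + 1) : ℕ) : ℝ[X]) = 0 := by push_cast; exact h2
    exact absurd (Nat.cast_eq_zero.mp this) (by omega)

/-- `Wr[H_{k_0}, …, H_{k_{n-1}}]` for an arbitrary sequence `k`; the polynomial `hermiteWr lam` is
the case `k = gapSeq lam`. -/
def seqWr {n : ℕ} (k : Fin n → ℕ) : ℝ[X] := wronskianDet fun i => hermiteH (k i)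

/-- The sequence `k` followed by `a`. -/
abbrev snocN {n : ℕ} (k : Fin n → ℕ) (a : ℕ) : Fin (n + 1) → ℕ := Fin.snoc (α := fun _ => ℕ) k a

theorem hermiteH_snocN {n : ℕ} (k : Fin n → ℕ) (a : ℕ) :
    (fun i => hermiteH (snocN k a i)) = snocP (fun i => hermiteH (k i)) (hermiteH a) := by
  ext1 i
  induction i using Fin.lastCases <;> simp

theorem injective_of_injective_snocN {n : ℕ} {k : Fin n → ℕ} {a : ℕ}
    (h : (snocN k a).Injective) : k.Injective := fun i j hij =>
  Fin.castSucc_injective n (@h i.castSucc j.castSucc (by simpa using hij))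

theorem seqWr_snocN_snocN_mul {n : ℕ} (k : Fin n → ℕ) (hk : seqWr k ≠ 0) (a b : ℕ) :
    seqWr (snocN (snocN k a) b) * seqWr k =
      seqWr (snocN k a) * derivative (seqWr (snocN k b)) -
        derivative (seqWr (snocN k a)) * seqWr (snocN k b) := by
  have := wronskianDet_snoc_snoc_mul (fun i => hermiteH (k i)) (hermiteH a) (hermiteH b) hk
  rwa [← hermiteH_snocN, ← hermiteH_snocN, ← hermiteH_snocN] at this

/-- Bilinear form of Crum's theorem. With `W = Wr[H_k]`, `W_i = Wr[H_k, H_i]` and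
`w = Wr[H_k, H_i, H_j]`, the Wronskian `w / W` of the quotients `W_i / W` and `W_j / W` satisfies
`(w / W)' - 2x w / W = 2 (i - j) W_i W_j / W²`, so these quotients behave like eigenfunctions of one
and the same Schrödinger operator. The equation is stated with denominators cleared. -/
def IsDarboux {n : ℕ} (k : Fin n → ℕ) : Prop := ∀ i j : ℕ,
  derivative (seqWr (snocN (snocN k i) j)) * seqWr k -
      seqWr (snocN (snocN k i) j) * derivative (seqWr k) -
    2 * X * seqWr (snocN (snocN k i) j) * seqWr k =
  2 * ((i : ℝ[X]) - (j : ℝ[X])) * seqWr (snocN k i) * seqWr (snocN k j)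

/-- Three-term (Plücker) relation between Wronskians with one and two additional functions. -/
theorem seqWr_plucker {n : ℕ} (k : Fin n → ℕ) (hk : seqWr k ≠ 0) (u i j : ℕ) :
    seqWr (snocN k u) * seqWr (snocN (snocN k i) j) -
      seqWr (snocN k i) * seqWr (snocN (snocN k u) j) +
      seqWr (snocN k j) * seqWr (snocN (snocN k u) i) = 0 := by
  refine mul_right_cancel₀ hk ?_
  linear_combination seqWr (snocN k u) * seqWr_snocN_snocN_mul k hk i j -
    seqWr (snocN k i) * seqWr_snocN_snocN_mul k hk u j +
    seqWr (snocN k j) * seqWr_snocN_snocN_mul k hk u i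

/-- The Wronskian with three additional functions, reduced to Wronskians with fewer: the derivatives
in the Desnanot–Jacobi identity are eliminated by Crum's relation. -/
theorem IsDarboux.mul_seqWr {n : ℕ} {k : Fin n → ℕ} (h : IsDarboux k) (u : ℕ)
    (hu : seqWr (snocN k u) ≠ 0) (i j : ℕ) :
    seqWr k * seqWr (snocN (snocN (snocN k u) i) j) =
      2 * (((u : ℝ[X]) - j) * seqWr (snocN k j) * seqWr (snocN (snocN k u) i) -
        ((u : ℝ[X]) - i) * seqWr (snocN k i) * seqWr (snocN (snocN k u) j)) := by
  refine mul_left_cancel₀ hu ?_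
  linear_combination seqWr k * seqWr_snocN_snocN_mul (snocN k u) hu i j +
    seqWr (snocN (snocN k u) i) * h u j - seqWr (snocN (snocN k u) j) * h u i

/-- One Darboux step: Crum's relation passes from `k` to `k` followed by `u`. Real zeros of
`Wr[H_k]` do not matter here, all relations being between polynomials. -/
theorem IsDarboux.snoc {n : ℕ} {k : Fin n → ℕ} (h : IsDarboux k) (hk : seqWr k ≠ 0) {u : ℕ}
    (hu : seqWr (snocN k u) ≠ 0) : IsDarboux (snocN k u) := by
  intro i j
  have h1 := h.mul_seqWr u hu i j
  -- With the derivative of `h1`, the second derivatives that the Desnanot–Jacobi identity would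
  -- bring in do not arise.
  have h2 := congrArg derivative h1
  simp only [derivative_mul, derivative_sub, derivative_natCast, derivative_ofNat] at h2
  refine mul_left_cancel₀ (pow_ne_zero 2 hk) ?_
  linear_combination seqWr (snocN k u) * seqWr k * h2 -
    (seqWr (snocN k u) * derivative (seqWr k) +
      seqWr k * derivative (seqWr (snocN k u)) +
      2 * X * seqWr k * seqWr (snocN k u)) * h1 +
    2 * ((u : ℝ[X]) - j) * seqWr (snocN k u) * seqWr (snocN k j) * h u i -
    2 * ((u : ℝ[X]) - i) * seqWr (snocN k u) * seqWr (snocN k i) * h u j -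
    2 * seqWr k * ((u : ℝ[X]) - j) * seqWr (snocN (snocN k u) i) *
      seqWr_snocN_snocN_mul k hk u j +
    2 * seqWr k * ((u : ℝ[X]) - i) * seqWr (snocN (snocN k u) j) *
      seqWr_snocN_snocN_mul k hk u i

theorem seqWr_empty (k : Fin 0 → ℕ) : seqWr k = 1 := by simp [seqWr, wronskianDet]

theorem seqWr_snocN_empty (k : Fin 0 → ℕ) (a : ℕ) : seqWr (snocN k a) = hermiteH a := by
  simp [seqWr, wronskianDet, snocN, Fin.snoc]

theorem isDarboux_empty (k : Fin 0 → ℕ) : IsDarboux k := by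
  intro i j
  have h := seqWr_snocN_snocN_mul k (by simp [seqWr_empty]) i j
  simp only [seqWr_snocN_empty, seqWr_empty, mul_one] at h ⊢
  simp only [h, derivative_mul, derivative_sub, derivative_derivative_hermiteH, derivative_one]
  ring

/-- The nonvanishing of Wronskians with one and two further entries is carried along with Crum's
relation: if `Wr[H_k, H_u, H_v]` were zero, Crum's relation would give `(u - v) W_u W_v = 0`. -/
theorem seqWr_ne_zero_and_isDarboux (n : ℕ) : ∀ k : Fin n → ℕ, k.Injective →
    seqWr k ≠ 0 ∧ (∀ u, u ∉ Set.range k → seqWr (snocN k u) ≠ 0) ∧ IsDarboux k := by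
  induction n with
  | zero =>
    intro k _
    exact ⟨by simp [seqWr_empty], fun u _ => by simp [seqWr_snocN_empty, hermiteH_ne_zero],
      isDarboux_empty k⟩
  | succ n ih =>
    intro k' hk'
    obtain ⟨k, u, rfl⟩ : ∃ k u, k' = snocN k u :=
      ⟨Fin.init k', k' (Fin.last n), (Fin.snoc_init_self k').symm⟩
    have hk := injective_of_injective_snocN hk'
    have hu : u ∉ Set.range k := by
      rintro ⟨a, ha⟩
      have := @hk' a.castSucc (Fin.last n) (by simpa using ha)
      exact (Fin.castSucc_lt_last a).ne this
    obtain ⟨h1, h2, h3⟩ := ih k hk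
    refine ⟨h2 u hu, fun v hv h0 => ?_, h3.snoc h1 (h2 u hu)⟩
    have hvu : u ≠ v := fun h => hv ⟨Fin.last n, by simpa using h⟩
    have hvk : v ∉ Set.range k := by
      rintro ⟨a, ha⟩
      exact hv ⟨a.castSucc, by simpa using ha⟩
    have h4 := h3 u v
    rw [h0] at h4
    simp only [derivative_zero, zero_mul, mul_zero, sub_zero, eq_comm (a := (0 : ℝ[X])),
      mul_eq_zero, h2 u hu, h2 v hvk, or_false, two_ne_zero, false_or, sub_eq_zero,
      Nat.cast_inj] at h4
    exact hvu h4

theorem seqWr_ne_zero {n : ℕ} {k : Fin n → ℕ} (hk : k.Injective) : seqWr k ≠ 0 :=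
  (seqWr_ne_zero_and_isDarboux n k hk).1

theorem isDarboux {n : ℕ} {k : Fin n → ℕ} (hk : k.Injective) : IsDarboux k :=
  (seqWr_ne_zero_and_isDarboux n k hk).2.2

/-- Adjoining two entries `u, v` at once: up to a constant factor, the difference of the integrands
of the orthogonality relations at the two levels is the derivative of
`Wr[H_k, H_u, H_f] Wr[H_k, H_v, H_g] / (Wr[H_k] Wr[H_k, H_u, H_v]) · exp (-x²)`. The possible zeros
of `Wr[H_k, H_u]` do not occur in the denominator. -/
theorem IsDarboux.two_step {n : ℕ} {k : Fin n → ℕ} (h : IsDarboux k) (hk : seqWr k ≠ 0) {u v : ℕ}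
    (hu : seqWr (snocN k u) ≠ 0) (f g : ℕ) :
    let W := seqWr k
    let w := seqWr (snocN (snocN k u) v)
    let N := seqWr (snocN (snocN k u) f) * seqWr (snocN (snocN k v) g)
    2 * ((u : ℝ[X]) - (v : ℝ[X])) *
        (derivative N * (W * w) - N * derivative (W * w) - 2 * X * N * (W * w)) =
      4 * ((g : ℝ[X]) - (v : ℝ[X])) * ((f : ℝ[X]) - (u : ℝ[X])) *
          (seqWr (snocN k f) * seqWr (snocN k g)) * w ^ 2 -
        seqWr (snocN (snocN (snocN k u) v) f) *
          seqWr (snocN (snocN (snocN k u) v) g) * W ^ 2 := by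
  intro W w N
  have e1 := h.mul_seqWr u hu v f
  have e2 := h.mul_seqWr u hu v g
  have p := seqWr_plucker k hk u v g
  have huf := h u f
  have hvg := h v g
  have huv := h u v
  simp only [W, w, N, derivative_mul]
  generalize seqWr k = W at *
  generalize seqWr (snocN (snocN k u) v) = w at *
  generalize seqWr (snocN (snocN k u) f) = wuf at *
  generalize seqWr (snocN (snocN k v) g) = wvg at *
  generalize seqWr (snocN (snocN k u) g) = wug at *
  generalize seqWr (snocN (snocN (snocN k u) v) f) = Ωf at *
  generalize seqWr (snocN (snocN (snocN k u) v) g) = Ωg at *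
  generalize seqWr (snocN k u) = U at *
  generalize seqWr (snocN k v) = V at *
  generalize seqWr (snocN k f) = F at *
  generalize seqWr (snocN k g) = G at *
  linear_combination 2 * ((u : ℝ[X]) - v) * (w * wvg * huf + w * wuf * hvg - wuf * wvg * huv) +
    W * Ωg * e1 + 2 * ((u - f) * F * w - (u - v) * V * wuf) * e2 +
    (4 * ((u : ℝ[X]) - v) * ((u - f) * F * w - (u - v) * V * wuf)) * p

/-! ### Integrals against the Gaussian weight -/

theorem integrable_eval_mul_exp (P : ℝ[X]) :
    Integrable fun x : ℝ => P.eval x * Real.exp (-x ^ 2) := by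
  induction P using Polynomial.induction_on' with
  | add p q hp hq => 
    simp only [eval_add, add_mul]
    exact hp.add hq
  | monomial n a =>
    have h := integrable_rpow_mul_exp_neg_mul_sq (b := 1) one_pos (s := n)
      (lt_of_lt_of_le (by norm_num) n.cast_nonneg)
    simpa [mul_assoc] using h.const_mul a

theorem hasDerivAt_eval_mul_exp (P : ℝ[X]) (x : ℝ) :
    HasDerivAt (fun x : ℝ => P.eval x * Real.exp (-x ^ 2))
      ((derivative P - 2 * X * P).eval x * Real.exp (-x ^ 2)) x := by
  have h := (P.hasDerivAt x).mul (((hasDerivAt_id x).pow 2).neg.exp)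
  refine h.congr_deriv ?_
  simp
  ring

theorem exists_abs_inv_eval_le {Q : ℝ[X]} (hQ : ∀ x, Q.eval x ≠ 0) :
    ∃ C : ℝ, ∀ x, |(Q.eval x)⁻¹| ≤ C := by
  obtain ⟨x₀, h₀⟩ := Q.exists_forall_norm_le
  refine ⟨|(Q.eval x₀)⁻¹|, fun x => ?_⟩
  rw [abs_inv, abs_inv]
  exact inv_anti₀ (abs_pos.mpr (hQ x₀)) (h₀ x)

theorem integrable_div_mul_exp (P : ℝ[X]) {Q : ℝ[X]} (hQ : ∀ x, Q.eval x ≠ 0) :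
    Integrable fun x : ℝ => P.eval x / Q.eval x * Real.exp (-x ^ 2) := by
  obtain ⟨C, hC⟩ := exists_abs_inv_eval_le hQ
  have h := (integrable_eval_mul_exp P).bdd_mul (f := fun x => (Q.eval x)⁻¹) (c := C)
    (Q.continuous.inv₀ hQ).aestronglyMeasurable (Filter.Eventually.of_forall hC)
  refine h.congr (Filter.Eventually.of_forall fun x => ?_)
  simp only [div_eq_mul_inv]
  ring

theorem integral_derivative_div_mul_exp (P : ℝ[X]) {Q : ℝ[X]} (hQ : ∀ x, Q.eval x ≠ 0) :
    ∫ x : ℝ, (derivative P * Q - P * derivative Q - 2 * X * P * Q).eval x / (Q ^ 2).eval x *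
      Real.exp (-x ^ 2) = 0 := by
  refine integral_eq_zero_of_hasDerivAt_of_integrable
    (f := fun x => P.eval x / Q.eval x * Real.exp (-x ^ 2)) (fun x => ?_)
    (integrable_div_mul_exp _ fun x => by simpa using hQ x) (integrable_div_mul_exp P hQ)
  have h := ((P.hasDerivAt x).div (Q.hasDerivAt x) (hQ x)).mul
    (((hasDerivAt_id x).pow 2).neg.exp)
  refine h.congr_deriv ?_
  have := hQ x
  simp
  field_simp
  ring

/-- Integration by parts: multiplication by `2x` minus `d/dx` is adjoint to `d/dx` for the
weight. -/
theorem integral_hermiteH_succ_mul (n : ℕ) (G : ℝ[X]) :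
    ∫ x : ℝ, (hermiteH (n + 1) * G).eval x * Real.exp (-x ^ 2) =
      ∫ x : ℝ, (hermiteH n * derivative G).eval x * Real.exp (-x ^ 2) := by
  rw [eq_comm, ← sub_eq_zero,
    ← integral_sub (integrable_eval_mul_exp _) (integrable_eval_mul_exp _)]
  refine (integral_congr_ae (Filter.Eventually.of_forall fun x => ?_)).trans
    (integral_eq_zero_of_hasDerivAt_of_integrable
      (hasDerivAt_eval_mul_exp (hermiteH n * G)) (integrable_eval_mul_exp _)
      (integrable_eval_mul_exp _))
  simp only [hermiteH_succ, ← sub_mul, ← eval_sub, derivative_mul]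
  congr 2
  ring

theorem integral_hermiteH_mul_hermiteH (i j : ℕ) :
    ∫ x : ℝ, (hermiteH i * hermiteH j).eval x * Real.exp (-x ^ 2) =
      if i = j then √Real.pi * 2 ^ j * (Nat.factorial j : ℝ) else 0 := by
  induction i generalizing j with
  | zero =>
    cases j with
    | zero => simpa [hermiteH] using integral_gaussian 1
    | succ j =>
      rw [mul_comm, integral_hermiteH_succ_mul]
      simp [hermiteH]
  | succ i ih =>
    rw [integral_hermiteH_succ_mul]
    cases j with
    | zero => simp [hermiteH]
    | succ j =>
      have h : ∀ x : ℝ, (hermiteH i * derivative (hermiteH (j + 1))).eval x * Real.exp (-x ^ 2) =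
          (2 * (j + 1)) * ((hermiteH i * hermiteH j).eval x * Real.exp (-x ^ 2)) := by
        intro x
        rw [derivative_hermiteH_succ]
        simp
        ring
      simp_rw [h, integral_const_mul, ih, Nat.add_right_cancel_iff]
      split_ifs
      · rw [Nat.factorial_succ]
        push_cast
        ring
      · simp

/-! ### The norm recursion -/

/-- Adjoining the pair `u, v` multiplies the inner product of the quotients by
`4 (j - v) (i - u)`. -/
theorem integral_seqWr_two_step {n : ℕ} {k : Fin n → ℕ} {u v : ℕ}
    (hinj : (snocN k u).Injective) (hk : ∀ x, (seqWr k).eval x ≠ 0)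
    (hw : ∀ x, (seqWr (snocN (snocN k u) v)).eval x ≠ 0) (i j : ℕ) :
    ∫ x : ℝ, (seqWr (snocN (snocN (snocN k u) v) i) *
          seqWr (snocN (snocN (snocN k u) v) j)).eval x /
        (seqWr (snocN (snocN k u) v) ^ 2).eval x * Real.exp (-x ^ 2) =
      4 * ((j : ℝ) - v) * ((i : ℝ) - u) *
        ∫ x : ℝ, (seqWr (snocN k i) * seqWr (snocN k j)).eval x /
          (seqWr k ^ 2).eval x * Real.exp (-x ^ 2) := by
  have hkinj := injective_of_injective_snocN hinj
  have key := (isDarboux hkinj).two_step (v := v) (seqWr_ne_zero hkinj) (seqWr_ne_zero hinj) i j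
  have hzero := integral_derivative_div_mul_exp
    (seqWr (snocN (snocN k u) i) * seqWr (snocN (snocN k v) j))
    (Q := seqWr k * seqWr (snocN (snocN k u) v)) (fun x => by
      rw [eval_mul]; exact mul_ne_zero (hk x) (hw x))
  rw [← integral_const_mul, ← sub_eq_zero, ← integral_sub
    (integrable_div_mul_exp _ fun x => by rw [eval_pow]; exact pow_ne_zero 2 (hw x))
    ((integrable_div_mul_exp _ fun x => by
      rw [eval_pow]; exact pow_ne_zero 2 (hk x)).const_mul _)]
  rw [← mul_zero (-(2 * ((u : ℝ) - v))), ← hzero, ← integral_const_mul]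
  refine integral_congr_ae (Filter.Eventually.of_forall fun x => ?_)
  have hx := congrArg (eval x) key
  have h1 := hk x
  have h2 := hw x
  simp only [eval_mul, eval_sub, eval_pow, eval_natCast, eval_ofNat, eval_X] at hx ⊢
  field_simp
  linear_combination hx

theorem snocN_last {n : ℕ} (k : Fin n → ℕ) (a : ℕ) : snocN k a (Fin.last n) = a :=
  Fin.snoc_last (α := fun _ => ℕ) a k

theorem snocN_castSucc {n : ℕ} (k : Fin n → ℕ) (a : ℕ) (i : Fin n) : snocN k a i.castSucc = k i :=
  Fin.snoc_castSucc (α := fun _ => ℕ) a k i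

/-- Adjoining a largest part `m` to the partition adjoins the consecutive numbers `m + 2l` and
`m + 2l + 1` to the gap sequence of the double partition. -/
theorem gapSeq_double_succ {l : ℕ} (lam : Fin (l + 1) → ℕ) :
    gapSeq (double lam) = (snocN (snocN (gapSeq (double fun i : Fin l => lam i.castSucc))
      (lam (Fin.last l) + 2 * l)) (lam (Fin.last l) + 2 * l + 1) : Fin (2 * l + 1 + 1) → ℕ) := by
  change (gapSeq (double lam) : Fin (2 * l + 1 + 1) → ℕ) = _
  ext1 i
  induction i using Fin.lastCases with
  | last =>
    have : lam ⟨(2 * l + 1) / 2, by omega⟩ = lam (Fin.last l) :=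
      congrArg lam (Fin.ext (by simp only [Fin.val_last]; omega))
    rw [snocN_last]
    change lam ⟨(2 * l + 1) / 2, _⟩ + (2 * l + 1) = _
    rw [this, add_assoc]
  | cast i =>
    rw [snocN_castSucc]
    induction i using Fin.lastCases with
    | last =>
      have : lam ⟨(2 * l) / 2, by omega⟩ = lam (Fin.last l) :=
        congrArg lam (Fin.ext (by simp only [Fin.val_last]; omega))
      rw [snocN_last]
      change lam ⟨(2 * l) / 2, _⟩ + 2 * l = _
      rw [this]
    | cast i =>
      rw [snocN_castSucc]
      rfl

theorem monotone_double {l : ℕ} {lam : Fin l → ℕ} (h : Monotone lam) : Monotone (double lam) :=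
  fun _ _ hij => h (Nat.div_le_div_right hij)

theorem strictMono_gapSeq {n : ℕ} {lam : Fin n → ℕ} (h : Monotone lam) : StrictMono (gapSeq lam) :=
  fun _ _ hij => add_lt_add_of_le_of_lt (h hij.le) hij

/-! ### The Hermite operator -/

theorem C_half_mul_two : (C (1 / 2) * 2 : ℝ[X]) = 1 := by
  rw [← C_ofNat, ← C_mul]
  norm_num

/-- The Hermite operator `P ↦ x P' - P'' / 2`, with eigenvalue `n` on `H_n`. -/
def hermiteOp : Module.End ℝ ℝ[X] :=
  LinearMap.mulLeft ℝ X ∘ₗ derivative - (1 / 2 : ℝ) • (derivative ∘ₗ derivative)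

theorem hermiteOp_apply (P : ℝ[X]) :
    hermiteOp P = X * derivative P - C (1 / 2) * derivative (derivative P) := by
  simp [hermiteOp, smul_eq_C_mul]

theorem hermiteOp_hermiteH (n : ℕ) : hermiteOp (hermiteH n) = (n : ℝ) • hermiteH n := by
  rw [hermiteOp_apply, derivative_derivative_hermiteH, smul_eq_C_mul, C_eq_natCast]
  linear_combination ((n : ℝ[X]) * hermiteH n - X * derivative (hermiteH n)) * C_half_mul_two

theorem aeval_hermiteOp_hermiteH (P : ℝ[X]) (n : ℕ) :
    aeval hermiteOp P (hermiteH n) = P.eval (n : ℝ) • hermiteH n :=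
  Module.End.aeval_apply_of_hasEigenvector
    ⟨Module.End.mem_eigenspace_iff.mpr (hermiteOp_hermiteH n), hermiteH_ne_zero n⟩

theorem pow_dvd_hermiteOp {a : ℝ} {m : ℕ} {F : ℝ[X]} (h : (X - C a) ^ (m + 2) ∣ F) :
    (X - C a) ^ m ∣ hermiteOp F := by
  have h1 : (X - C a) ^ (m + 1) ∣ derivative F := by
    simpa using pow_sub_one_dvd_derivative_of_pow_dvd h
  have h2 : (X - C a) ^ m ∣ derivative (derivative F) := by
    simpa using pow_sub_one_dvd_derivative_of_pow_dvd h1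
  rw [hermiteOp_apply]
  exact dvd_sub (((pow_dvd_pow _ m.le_succ).trans h1).mul_left _) (h2.mul_left _)

/-! ### Integration over a half-line -/

/-- The integral of a polynomial over `(-∞, a]` against the weight `exp (-x²)`. -/
def halfInt (a : ℝ) : ℝ[X] →ₗ[ℝ] ℝ where
  toFun P := ∫ x in Set.Iic a, P.eval x * Real.exp (-x ^ 2)
  map_add' P Q := by
    simp only [eval_add, add_mul]
    exact integral_add (integrable_eval_mul_exp P).integrableOn
      (integrable_eval_mul_exp Q).integrableOn
  map_smul' c P := by
    simp only [eval_smul, smul_eq_mul, mul_assoc, integral_const_mul, RingHom.id_apply]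

theorem halfInt_apply (a : ℝ) (P : ℝ[X]) :
    halfInt a P = ∫ x in Set.Iic a, P.eval x * Real.exp (-x ^ 2) := rfl

theorem halfInt_derivative_sub (a : ℝ) (P : ℝ[X]) :
    halfInt a (derivative P - 2 * X * P) = P.eval a * Real.exp (-a ^ 2) := by
  have h := integral_Iic_of_hasDerivAt_of_tendsto' (a := a)
    (fun x _ => hasDerivAt_eval_mul_exp P x) (integrable_eval_mul_exp _).integrableOn
    (tendsto_zero_of_hasDerivAt_of_integrableOn_Iic (a := a)
      (fun x _ => hasDerivAt_eval_mul_exp P x) (integrable_eval_mul_exp _).integrableOn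
      (integrable_eval_mul_exp P).integrableOn)
  rwa [sub_zero] at h

/-- The Hermite operator is symmetric for the half-line pairing as soon as one of the two arguments
vanishes to second order at the end point. -/
theorem halfInt_hermiteOp_mul {a : ℝ} {F : ℝ[X]} (hF : (X - C a) ^ 2 ∣ F) (G : ℝ[X]) :
    halfInt a (hermiteOp F * G) = halfInt a (F * hermiteOp G) := by
  have h1 : F.eval a = 0 := by
    obtain ⟨Q, rfl⟩ := hF
    simp
  have h2 : (derivative F).eval a = 0 := by
    obtain ⟨Q, rfl⟩ := hF
    simp [derivative_pow]
  have h := halfInt_derivative_sub a (derivative F * G - F * derivative G)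
  simp only [eval_sub, eval_mul, h1, h2, zero_mul, sub_zero] at h
  rw [← sub_eq_zero, ← map_sub, ← mul_zero (-(1 / 2) : ℝ), ← h, ← smul_eq_mul (-(1 / 2) : ℝ),
    ← map_smul]
  congr 1
  rw [hermiteOp_apply, hermiteOp_apply, smul_eq_C_mul, C_neg]
  simp only [derivative_sub, derivative_mul]
  linear_combination X * (F * derivative G - G * derivative F) * C_half_mul_two

theorem halfInt_pow_hermiteOp_mul {a : ℝ} {l : ℕ} {F : ℝ[X]} (hF : (X - C a) ^ (2 * l) ∣ F)
    {i : ℕ} (hi : i ≤ l) (G : ℝ[X]) :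
    halfInt a ((hermiteOp ^ i) F * G) = halfInt a (F * (hermiteOp ^ i) G) := by
  have hdvd : ∀ i ≤ l, (X - C a) ^ (2 * (l - i)) ∣ (hermiteOp ^ i) F := by
    intro i
    induction i with
    | zero => simpa using hF
    | succ i ih =>
      intro hi
      rw [pow_succ', Module.End.mul_apply]
      refine pow_dvd_hermiteOp ?_
      convert ih (by omega) using 2
      omega
  induction i generalizing G with
  | zero => simp
  | succ i ih =>
    rw [pow_succ', Module.End.mul_apply, halfInt_hermiteOp_mul
      ((pow_dvd_pow _ (by omega)).trans (hdvd i (by omega))), ih (by omega), ← pow_succ',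
      pow_succ, Module.End.mul_apply]

/-- The operator `P(A)`, with `A` the Hermite operator, may be moved across the half-line pairing
when `F` vanishes to order `2 deg P` at the end point: all boundary terms vanish. -/
theorem halfInt_aeval_hermiteOp_mul {a : ℝ} {l : ℕ} {F : ℝ[X]} (hF : (X - C a) ^ (2 * l) ∣ F)
    {P : ℝ[X]} (hP : P.natDegree ≤ l) (G : ℝ[X]) :
    halfInt a (aeval hermiteOp P F * G) = halfInt a (F * aeval hermiteOp P G) := by
  rw [aeval_eq_sum_range' (Nat.lt_succ_of_le hP)]
  simp only [LinearMap.sum_apply, LinearMap.smul_apply, Finset.sum_mul, Finset.mul_sum, map_sum,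
    smul_mul_assoc, mul_smul_comm, map_smul]
  refine Finset.sum_congr rfl fun i hi => ?_
  rw [halfInt_pow_hermiteOp_mul hF (Nat.lt_succ_iff.mp (Finset.mem_range.mp hi))]

/-- At a zero `a` of the Wronskian the columns are dependent: some nontrivial combination of the
`H_k` vanishes to order `n` at `a`. -/
theorem exists_combination_of_seqWr_eval_eq_zero {n : ℕ} {k : Fin n → ℕ} (hk : k.Injective)
    {a : ℝ} (h : (seqWr k).eval a = 0) :
    ∃ c : Fin n → ℝ, ∑ i, c i • hermiteH (k i) ≠ 0 ∧
      (X - C a) ^ n ∣ ∑ i, c i • hermiteH (k i) := by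
  rw [seqWr, wronskianDet, ← coe_evalRingHom, RingHom.map_det] at h
  obtain ⟨c, hc, hc0⟩ := Matrix.exists_mulVec_eq_zero_iff.mpr h
  -- Distinct Hermite polynomials are independent, being orthogonal.
  have hF : ∑ i, c i • hermiteH (k i) ≠ 0 := by
    intro h0
    apply hc
    ext1 j
    have h1 : ∫ x : ℝ, ((∑ i, c i • hermiteH (k i)) * hermiteH (k j)).eval x *
        Real.exp (-x ^ 2) = 0 := by simp [h0]
    have h2 : ∀ x : ℝ, ((∑ i, c i • hermiteH (k i)) * hermiteH (k j)).eval x *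
        Real.exp (-x ^ 2) =
        ∑ i, c i * ((hermiteH (k i) * hermiteH (k j)).eval x * Real.exp (-x ^ 2)) := by
      intro x
      simp [eval_finsetSum, Finset.sum_mul, mul_assoc]
    simp_rw [h2] at h1
    rw [integral_finsetSum _ fun i _ => (integrable_eval_mul_exp _).const_mul _] at h1
    simp_rw [integral_const_mul, integral_hermiteH_mul_hermiteH, hk.eq_iff] at h1
    simp only [mul_ite, mul_zero, Finset.sum_ite_eq', Finset.mem_univ, if_true] at h1
    have : √Real.pi * 2 ^ k j * (Nat.factorial (k j) : ℝ) ≠ 0 := by positivity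
    exact (mul_eq_zero.mp h1).resolve_right this
  refine ⟨c, hF, ?_⟩
  rw [← le_rootMultiplicity_iff hF]
  cases n with
  | zero => simp
  | succ n =>
    rw [Nat.succ_le_iff, lt_rootMultiplicity_iff_isRoot_iterate_derivative hF]
    intro m hm
    have := congrFun hc0 ⟨m, by omega⟩
    simp only [Matrix.mulVec, dotProduct, RingHom.mapMatrix_apply, Matrix.map_apply,
      Matrix.of_apply, Pi.zero_apply, coe_evalRingHom] at this
    rw [IsRoot, iterate_derivative_sum, eval_finsetSum, ← this]
    refine Finset.sum_congr rfl fun i _ => ?_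
    rw [iterate_derivative_smul, eval_smul, smul_eq_mul, mul_comm]

/-! ### Completeness of the Hermite functions -/

theorem integrable_exp_abs_mul {g : ℝ → ℝ} (hg : MemLp g 2) (t : ℝ) :
    Integrable fun x : ℝ => Real.exp (t * |x|) * (Real.exp (-x ^ 2 / 2) * g x) := by
  have h1 : MemLp (fun x : ℝ => Real.exp (t * |x|) * Real.exp (-x ^ 2 / 2)) 2 := by
    rw [memLp_two_iff_integrable_sq (by fun_prop)]
    have h2 := ((integrable_exp_neg_mul_sq (b := 1 / 2) (by norm_num)).const_mul
      (Real.exp (2 * t ^ 2)))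
    refine h2.mono' (by fun_prop) (Filter.Eventually.of_forall fun x => ?_)
    rw [Real.norm_of_nonneg (by positivity), ← Real.exp_add, ← Real.exp_add, ← Real.exp_nat_mul,
      Real.exp_le_exp]
    push_cast
    -- `2t|x| - x² ≤ 2t² - x² / 2`
    nlinarith [sq_nonneg (2 * t - |x|), sq_abs x]
  have h3 := h1.integrable_mul hg
  refine h3.congr (Filter.Eventually.of_forall fun x => ?_)
  simp only [Pi.mul_apply]
  ring

/-- An integrable function with vanishing Fourier transform vanishes almost everywhere: its positive
and negative parts are densities of finite measures with equal characteristic functions. -/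
theorem ae_eq_zero_of_forall_integral_cexp {h : ℝ → ℝ} (hh : Integrable h)
    (h0 : ∀ t : ℝ, ∫ x : ℝ, Complex.exp (t * x * Complex.I) * (h x : ℂ) = 0) :
    h =ᵐ[volume] 0 := by
  have hm : AEMeasurable h := hh.aestronglyMeasurable.aemeasurable
  have hfin : ∀ f : ℝ → ℝ, Integrable f →
      IsFiniteMeasure (volume.withDensity fun x => ENNReal.ofReal (f x)) := fun f hf =>
    isFiniteMeasure_withDensity_ofReal hf.2
  have := hfin h hh
  have hneg : Integrable fun x => -h x := hh.neg
  have hmneg : AEMeasurable fun x => -h x := hm.neg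
  have := hfin (fun x => -h x) hneg
  have hchar : ∀ (f : ℝ → ℝ), Integrable f → ∀ t : ℝ,
      charFun (volume.withDensity fun x => ENNReal.ofReal (f x)) t =
        ∫ x : ℝ, Complex.exp (t * x * Complex.I) * ((max (f x) 0 : ℝ) : ℂ) := by
    intro f hf t
    rw [charFun_apply_real, integral_withDensity_eq_integral_toReal_smul₀
      hf.aestronglyMeasurable.aemeasurable.ennreal_ofReal
      (Filter.Eventually.of_forall fun x => ENNReal.ofReal_lt_top)]
    refine integral_congr_ae (Filter.Eventually.of_forall fun x => ?_)
    simp only [ENNReal.toReal_ofReal', Complex.real_smul]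
    ring
  have hint : ∀ (f : ℝ → ℝ), Integrable f → ∀ t : ℝ, Integrable fun x : ℝ =>
      Complex.exp (t * x * Complex.I) * ((max (f x) 0 : ℝ) : ℂ) := by
    intro f hf t
    refine hf.pos_part.ofReal.bdd_mul (c := 1) (by fun_prop)
      (Filter.Eventually.of_forall fun x => ?_)
    rw [← Complex.ofReal_mul, Complex.norm_exp_ofReal_mul_I]
  have heq : (volume.withDensity fun x => ENNReal.ofReal (h x)) =
      volume.withDensity fun x => ENNReal.ofReal (-h x) := by
    refine Measure.ext_of_charFun (funext fun t => ?_)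
    rw [hchar h hh, hchar _ hneg, ← sub_eq_zero, ← integral_sub (hint h hh t)
      (hint _ hneg t), ← h0 t]
    refine integral_congr_ae (Filter.Eventually.of_forall fun x => ?_)
    simp only
    rw [← mul_sub, ← Complex.ofReal_sub]
    congr 2
    rcases le_total (h x) 0 with hx | hx
    · rw [max_eq_right hx, max_eq_left (by linarith)]; ring
    · rw [max_eq_left hx, max_eq_right (by linarith)]; ring
  rw [withDensity_eq_iff hm.ennreal_ofReal hmneg.ennreal_ofReal hh.lintegral_lt_top.ne] at heq
  filter_upwards [heq] with x hx
  rcases le_total (h x) 0 with hx' | hx'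
  · rw [ENNReal.ofReal_eq_zero.mpr hx', eq_comm, ENNReal.ofReal_eq_zero] at hx
    simpa using le_antisymm hx' (by linarith)
  · rw [ENNReal.ofReal_eq_zero.mpr (by linarith : -h x ≤ 0), ENNReal.ofReal_eq_zero] at hx
    simpa using le_antisymm hx hx'

/-- Completeness of the Hermite functions: the Fourier transform of `exp (-x² / 2) g` is the sum of
the exponential series formed from its moments, all of which vanish. -/
theorem ae_eq_zero_of_forall_integral_eval_mul {g : ℝ → ℝ} (hg : MemLp g 2)
    (h0 : ∀ P : ℝ[X], ∫ x : ℝ, P.eval x * Real.exp (-x ^ 2 / 2) * g x = 0) :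
    g =ᵐ[volume] 0 := by
  have hint : Integrable fun x : ℝ => Real.exp (-x ^ 2 / 2) * g x := by
    simpa using integrable_exp_abs_mul hg 0
  have key := ae_eq_zero_of_forall_integral_cexp hint fun t => by
    have hs := hasSum_integral_of_dominated_convergence (μ := volume)
      (F := fun (n : ℕ) (x : ℝ) => (t * x * Complex.I) ^ n / (n.factorial : ℂ) *
        ((Real.exp (-x ^ 2 / 2) * g x : ℝ) : ℂ))
      (f := fun x : ℝ => Complex.exp (t * x * Complex.I) *
        ((Real.exp (-x ^ 2 / 2) * g x : ℝ) : ℂ))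
      (bound := fun n x => (|t| * |x|) ^ n / (n.factorial : ℝ) * |Real.exp (-x ^ 2 / 2) * g x|)
      (fun n => by
        have := hint.aestronglyMeasurable
        exact (by fun_prop : AEStronglyMeasurable
          (fun x : ℝ => (t * x * Complex.I) ^ n / (n.factorial : ℂ)) volume).mul
          (Complex.continuous_ofReal.comp_aestronglyMeasurable this))
      (fun n => Filter.Eventually.of_forall fun x => by
        rw [norm_mul, Complex.norm_real, Real.norm_eq_abs, norm_div, norm_pow, norm_mul, norm_mul,
          Complex.norm_I, mul_one, Complex.norm_real, Complex.norm_real, Complex.norm_natCast,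
          Real.norm_eq_abs, Real.norm_eq_abs])
      (Filter.Eventually.of_forall fun x => (Real.summable_pow_div_factorial _).mul_right _)
      (by
        refine (integrable_exp_abs_mul hg |t|).abs.congr (Filter.Eventually.of_forall fun x => ?_)
        simp only
        rw [tsum_mul_right, abs_mul, abs_of_pos (Real.exp_pos (|t| * |x|)),
          Real.exp_eq_exp_ℝ, (NormedSpace.expSeries_div_hasSum_exp (|t| * |x|)).tsum_eq])
      (Filter.Eventually.of_forall fun x => by
        refine HasSum.mul_right _ ?_
        rw [Complex.exp_eq_exp_ℂ]
        exact NormedSpace.expSeries_div_hasSum_exp _)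
    refine hs.unique ?_
    convert hasSum_zero with n
    have h1 := h0 (X ^ n)
    have h2 : ∀ x : ℝ, (t * x * Complex.I) ^ n / (n.factorial : ℂ) *
        ((Real.exp (-x ^ 2 / 2) * g x : ℝ) : ℂ) = (t * Complex.I) ^ n / (n.factorial : ℂ) *
        (((X ^ n : ℝ[X]).eval x * Real.exp (-x ^ 2 / 2) * g x : ℝ) : ℂ) := by
      intro x
      simp only [eval_pow, eval_X, Complex.ofReal_mul, Complex.ofReal_pow]
      ring
    simp_rw [h2]
    rw [integral_const_mul, integral_complex_ofReal, h1]
    simp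
  filter_upwards [key] with x hx
  exact (mul_eq_zero.mp hx).resolve_left (Real.exp_pos _).ne'

/-! ### Parseval's identity on a half-line -/

theorem exp_half_mul_self (x : ℝ) :
    Real.exp (-x ^ 2 / 2) * Real.exp (-x ^ 2 / 2) = Real.exp (-x ^ 2) := by
  rw [← Real.exp_add]
  congr 1
  ring

theorem memLp_indicator_eval_mul_exp {s : Set ℝ} (hs : MeasurableSet s) (P : ℝ[X]) :
    MemLp (s.indicator fun x : ℝ => P.eval x * Real.exp (-x ^ 2 / 2)) 2 := by
  refine MemLp.indicator hs ?_
  rw [memLp_two_iff_integrable_sq (by fun_prop)]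
  refine (integrable_eval_mul_exp (P ^ 2)).congr (Filter.Eventually.of_forall fun x => ?_)
  simp only [eval_pow, ← exp_half_mul_self]
  ring

/-- The restriction of `P(x) exp (-x² / 2)` to `s`, extended by zero, as an element of `L²(ℝ)`. -/
def cutLp {s : Set ℝ} (hs : MeasurableSet s) (P : ℝ[X]) : Lp ℝ 2 (volume : Measure ℝ) :=
  (memLp_indicator_eval_mul_exp hs P).toLp

theorem coeFn_cutLp {s : Set ℝ} (hs : MeasurableSet s) (P : ℝ[X]) :
    cutLp hs P =ᵐ[volume] s.indicator fun x : ℝ => P.eval x * Real.exp (-x ^ 2 / 2) :=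
  MemLp.coeFn_toLp _

theorem inner_cutLp {s t : Set ℝ} (hs : MeasurableSet s) (ht : MeasurableSet t) (P Q : ℝ[X]) :
    inner ℝ (cutLp hs P) (cutLp ht Q) =
      ∫ x in s ∩ t, (P * Q).eval x * Real.exp (-x ^ 2) := by
  rw [L2.inner_def, ← integral_indicator (hs.inter ht)]
  refine integral_congr_ae ?_
  filter_upwards [coeFn_cutLp hs P, coeFn_cutLp ht Q] with x h1 h2
  rw [h1, h2]
  by_cases hxs : x ∈ s <;> by_cases hxt : x ∈ t <;> simp [hxs, hxt, ← exp_half_mul_self]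
  ring

/-- The full-line embedding of polynomials into `L²(ℝ)` as a linear map. -/
def fullLp : ℝ[X] →ₗ[ℝ] Lp ℝ 2 (volume : Measure ℝ) where
  toFun := cutLp MeasurableSet.univ
  map_add' P Q := by
    apply Lp.ext
    filter_upwards [coeFn_cutLp MeasurableSet.univ P, coeFn_cutLp MeasurableSet.univ Q,
      coeFn_cutLp MeasurableSet.univ (P + Q), Lp.coeFn_add (cutLp MeasurableSet.univ P)
        (cutLp MeasurableSet.univ Q)] with x h1 h2 h3 h4
    rw [h3, h4, Pi.add_apply, h1, h2]
    simp [add_mul]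
  map_smul' c P := by
    apply Lp.ext
    filter_upwards [coeFn_cutLp MeasurableSet.univ P,
      coeFn_cutLp MeasurableSet.univ (c • P), Lp.coeFn_smul c (cutLp MeasurableSet.univ P)]
      with x h1 h2 h3
    rw [RingHom.id_apply, h2, h3, Pi.smul_apply, h1]
    simp [mul_assoc]

theorem coeFn_fullLp (P : ℝ[X]) :
    fullLp P =ᵐ[volume] fun x : ℝ => P.eval x * Real.exp (-x ^ 2 / 2) := by
  have h := coeFn_cutLp MeasurableSet.univ P
  rw [Set.indicator_univ] at h
  exact h

theorem inner_fullLp_hermiteH (i j : ℕ) :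
    inner ℝ (fullLp (hermiteH i)) (fullLp (hermiteH j)) =
      if i = j then √Real.pi * 2 ^ j * (Nat.factorial j : ℝ) else 0 := by
  rw [← integral_hermiteH_mul_hermiteH]
  exact (inner_cutLp MeasurableSet.univ MeasurableSet.univ _ _).trans (by simp)

/-- The span of the Hermite polynomials contains `1` and is stable under multiplication by `X`, by
the three-term recurrence. -/
theorem span_range_hermiteH : Submodule.span ℝ (Set.range hermiteH) = ⊤ := by
  have hX : ∀ P ∈ Submodule.span ℝ (Set.range hermiteH),
      X * P ∈ Submodule.span ℝ (Set.range hermiteH) := by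
    intro P hP
    induction hP using Submodule.span_induction with
    | mem P hP =>
      obtain ⟨n, rfl⟩ := hP
      have h1 : X * hermiteH n =
          (1 / 2 : ℝ) • hermiteH (n + 1) + (n : ℝ) • hermiteH (n - 1) := by
        rw [hermiteH_succ, smul_eq_C_mul, smul_eq_C_mul, C_eq_natCast]
        cases n with
        | zero =>
          simp only [hermiteH, derivative_one]
          push_cast
          linear_combination -X * C_half_mul_two
        | succ n =>
          rw [derivative_hermiteH_succ, Nat.add_sub_cancel]
          push_cast
          linear_combination (-X * hermiteH (n + 1) + (n + 1) * hermiteH n) * C_half_mul_two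
      rw [h1]
      exact add_mem (Submodule.smul_mem _ _ (Submodule.subset_span ⟨_, rfl⟩))
        (Submodule.smul_mem _ _ (Submodule.subset_span ⟨_, rfl⟩))
    | zero => simp
    | add P Q _ _ hP hQ => rw [mul_add]; exact add_mem hP hQ
    | smul c P _ hP => rw [mul_smul_comm]; exact Submodule.smul_mem _ _ hP
  refine Submodule.eq_top_iff'.mpr fun P => ?_
  induction P using Polynomial.induction_on' with
  | add P Q hP hQ => exact add_mem hP hQ
  | monomial n a =>
    rw [← mul_one a, ← smul_eq_mul, ← smul_monomial, ← X_pow_eq_monomial]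
    refine Submodule.smul_mem _ _ ?_
    induction n with
    | zero => exact Submodule.subset_span ⟨0, by simp [hermiteH]⟩
    | succ n ih => rw [pow_succ']; exact hX _ ih

/-- The squared norm of `H_n`. -/
def normSqH (n : ℕ) : ℝ := √Real.pi * 2 ^ n * (Nat.factorial n : ℝ)

theorem normSqH_pos (n : ℕ) : 0 < normSqH n := by
  unfold normSqH
  positivity

/-- The normalized Hermite functions. -/
def hermiteFn (n : ℕ) : Lp ℝ 2 (volume : Measure ℝ) := (√(normSqH n))⁻¹ • fullLp (hermiteH n)

theorem orthonormal_hermiteFn : Orthonormal ℝ hermiteFn := by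
  rw [orthonormal_iff_ite]
  intro i j
  rw [hermiteFn, hermiteFn, real_inner_smul_left, real_inner_smul_right, inner_fullLp_hermiteH]
  change _ * (_ * if i = j then normSqH j else 0) = _
  split_ifs with h
  · subst h
    have h1 := normSqH_pos i
    have h2 := Real.sqrt_pos.mpr h1
    field_simp
    rw [Real.sq_sqrt h1.le]
  · simp

theorem span_range_hermiteFn_orthogonal : (Submodule.span ℝ (Set.range hermiteFn))ᗮ = ⊥ := by
  rw [eq_bot_iff]
  intro g hg
  rw [Submodule.mem_orthogonal] at hg
  have h1 : ∀ n, inner ℝ (fullLp (hermiteH n)) g = 0 := by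
    intro n
    have h := hg _ (Submodule.subset_span ⟨n, rfl⟩)
    rw [hermiteFn, real_inner_smul_left] at h
    exact (mul_eq_zero.mp h).resolve_left
      (inv_ne_zero (Real.sqrt_pos.mpr (normSqH_pos n)).ne')
  have h2 : ∀ P : ℝ[X], inner ℝ (fullLp P) g = 0 := by
    intro P
    have hP : P ∈ Submodule.span ℝ (Set.range hermiteH) := span_range_hermiteH ▸ trivial
    induction hP using Submodule.span_induction with
    | mem P hP =>
      obtain ⟨n, rfl⟩ := hP
      exact h1 n
    | zero => simp
    | add P Q _ _ hP hQ => rw [map_add, inner_add_left, hP, hQ, add_zero]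
    | smul c P _ hP => rw [map_smul, real_inner_smul_left, hP, mul_zero]
  rw [Submodule.mem_bot, Lp.eq_zero_iff_ae_eq_zero]
  refine ae_eq_zero_of_forall_integral_eval_mul (Lp.memLp g) fun P => ?_
  rw [← h2 P, L2.inner_def]
  refine integral_congr_ae ?_
  filter_upwards [coeFn_fullLp P] with x hx
  rw [hx]
  simp
  ring

/-- The Hilbert basis of `L²(ℝ)` formed by the normalized Hermite functions. -/
def hermiteBasis : HilbertBasis ℕ ℝ (Lp ℝ 2 (volume : Measure ℝ)) :=
  HilbertBasis.mkOfOrthogonalEqBot orthonormal_hermiteFn span_range_hermiteFn_orthogonal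

theorem hermiteBasis_apply (n : ℕ) : hermiteBasis n = hermiteFn n := by
  rw [hermiteBasis, HilbertBasis.coe_mkOfOrthogonalEqBot]

theorem inner_cutLp_Iic_hermiteFn (a : ℝ) (P : ℝ[X]) (n : ℕ) :
    inner ℝ (cutLp (measurableSet_Iic (a := a)) P) (hermiteFn n) =
      (√(normSqH n))⁻¹ * halfInt a (P * hermiteH n) := by
  rw [hermiteFn, real_inner_smul_right, halfInt_apply]
  congr 1
  exact (inner_cutLp measurableSet_Iic MeasurableSet.univ _ _).trans (by simp)

/-- Parseval's identity for polynomials restricted to `(-∞, a]`. -/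
theorem hasSum_halfInt_mul_halfInt (a : ℝ) (P Q : ℝ[X]) :
    HasSum (fun n => halfInt a (P * hermiteH n) * halfInt a (Q * hermiteH n) / normSqH n)
      (halfInt a (P * Q)) := by
  have h := hermiteBasis.hasSum_inner_mul_inner (cutLp (measurableSet_Iic (a := a)) P)
    (cutLp (measurableSet_Iic (a := a)) Q)
  rw [inner_cutLp, Set.inter_self, ← halfInt_apply] at h
  refine (congrArg (HasSum · (halfInt a (P * Q))) (funext fun n => ?_)).mp h
  rw [hermiteBasis_apply, inner_cutLp_Iic_hermiteFn,
    real_inner_comm, inner_cutLp_Iic_hermiteFn]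
  have h1 := normSqH_pos n
  have h2 := Real.sqrt_pos.mpr h1
  field_simp
  rw [Real.sq_sqrt h1.le]
  ring

/-- A polynomial that vanishes almost everywhere on a set of positive measure is zero. -/
theorem eq_zero_of_ae_eval_eq_zero {P : ℝ[X]} {s : Set ℝ} (hs : volume s ≠ 0)
    (h : ∀ᵐ x : ℝ, x ∈ s → P.eval x = 0) : P = 0 := by
  by_contra hP
  have hfin : volume {x : ℝ | P.eval x = 0} = 0 :=
    (Set.Finite.measure_zero (finite_setOfPred_isRoot hP) _)
  apply hs
  refine measure_mono_null (t := {x : ℝ | P.eval x = 0} ∪ {x | ¬ (x ∈ s → P.eval x = 0)}) ?_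
    (measure_union_null hfin h)
  intro x hx
  by_cases hx0 : P.eval x = 0
  · exact Or.inl hx0
  · exact Or.inr fun h => hx0 (h hx)

/-- A nonzero polynomial cut off at `a` has infinitely many nonzero Hermite coefficients: otherwise
it would be a polynomial times `exp (-x² / 2)` that vanishes on `(a, ∞)`. -/
theorem eq_zero_of_finite_halfInt {a : ℝ} {F : ℝ[X]} (S : Finset ℕ)
    (h : ∀ n ∉ S, halfInt a (F * hermiteH n) = 0) : F = 0 := by
  have h1 := hermiteBasis.hasSum_repr (cutLp (measurableSet_Iic (a := a)) F)
  have h2 := h1.unique (hasSum_sum_of_ne_finset_zero (s := S) fun n hn => by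
    rw [hermiteBasis.repr_apply_apply, hermiteBasis_apply, real_inner_comm,
      inner_cutLp_Iic_hermiteFn, h n hn]
    simp)
  obtain ⟨G, hG⟩ : ∃ G : ℝ[X], cutLp (measurableSet_Iic (a := a)) F = fullLp G := by
    refine ⟨∑ n ∈ S, (hermiteBasis.repr (cutLp (measurableSet_Iic (a := a)) F) n *
      (√(normSqH n))⁻¹) • hermiteH n, ?_⟩
    rw [map_sum, h2]
    refine Finset.sum_congr rfl fun n _ => ?_
    rw [hermiteBasis_apply, hermiteFn, map_smul, smul_smul, ← h2]
  have hae : (Set.Iic a).indicator (fun x : ℝ => F.eval x * Real.exp (-x ^ 2 / 2)) =ᵐ[volume]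
      fun x : ℝ => G.eval x * Real.exp (-x ^ 2 / 2) :=
    (coeFn_cutLp (measurableSet_Iic (a := a)) F).symm.trans (hG ▸ coeFn_fullLp G)
  have hG0 : G = 0 := by
    refine eq_zero_of_ae_eval_eq_zero (s := Set.Ioi a) (by simp) ?_
    filter_upwards [hae] with x hx hxa
    rw [Set.indicator_of_notMem (by simpa using hxa)] at hx
    exact (mul_eq_zero.mp hx.symm).resolve_right (Real.exp_pos _).ne'
  refine eq_zero_of_ae_eval_eq_zero (s := Set.Iic a) (by simp) ?_
  filter_upwards [hae] with x hx hxa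
  rw [Set.indicator_of_mem hxa, hG0, eval_zero, zero_mul] at hx
  exact (mul_eq_zero.mp hx).resolve_right (Real.exp_pos _).ne'

/-! ### Absence of real zeros -/

/-- Sufficient half of the Krein–Adler criterion. Let `P` and `Q` have degree at most `l`, with
`P Q` zero at the `2l` entries of `k` and positive at all other natural numbers. If the Wronskian
had a zero `a`, a combination `F` of the `H_k` would vanish there to order `2l`, which is enough to
move `P(A)` and `Q(A)`, with `A` the Hermite operator, across the half-line pairing. Parseval's
identity for `P(A) F` and `Q(A) F` on `(-∞, a]` is then a vanishing sum of nonnegative terms. -/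
theorem seqWr_eval_ne_zero_of_pairing {l : ℕ} {k : Fin (2 * l) → ℕ} (hk : k.Injective)
    {P Q : ℝ[X]} (hP : P.natDegree ≤ l) (hQ : Q.natDegree ≤ l)
    (hzero : ∀ i, (P * Q).eval (k i : ℝ) = 0)
    (hpos : ∀ n : ℕ, n ∉ Set.range k → 0 < (P * Q).eval (n : ℝ)) (a : ℝ) :
    (seqWr k).eval a ≠ 0 := by
  intro h0
  obtain ⟨c, hF, hdvd⟩ := exists_combination_of_seqWr_eval_eq_zero hk h0
  set F := ∑ i, c i • hermiteH (k i) with hFdef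
  -- `P Q` annihilates the eigenvalues of all summands of `F`.
  have hann : aeval hermiteOp (P * Q) F = 0 := by
    rw [hFdef, map_sum]
    refine Finset.sum_eq_zero fun i _ => ?_
    rw [map_smul, aeval_hermiteOp_hermiteH, hzero, zero_smul, smul_zero]
  have hpair : halfInt a (aeval hermiteOp P F * aeval hermiteOp Q F) = 0 := by
    rw [halfInt_aeval_hermiteOp_mul hdvd hP, ← Module.End.mul_apply, ← map_mul, hann, mul_zero,
      map_zero]
  have hcoef : ∀ R : ℝ[X], R.natDegree ≤ l → ∀ n,
      halfInt a (aeval hermiteOp R F * hermiteH n) =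
        R.eval (n : ℝ) * halfInt a (F * hermiteH n) := by
    intro R hR n
    rw [halfInt_aeval_hermiteOp_mul hdvd hR, aeval_hermiteOp_hermiteH, mul_smul_comm, map_smul,
      smul_eq_mul]
  have hsum := hasSum_halfInt_mul_halfInt a (aeval hermiteOp P F) (aeval hermiteOp Q F)
  rw [hpair] at hsum
  have hterm : ∀ n, halfInt a (aeval hermiteOp P F * hermiteH n) *
      halfInt a (aeval hermiteOp Q F * hermiteH n) / normSqH n =
        (P * Q).eval (n : ℝ) * (halfInt a (F * hermiteH n) ^ 2 / normSqH n) := by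
    intro n
    rw [hcoef P hP, hcoef Q hQ, eval_mul]
    ring
  simp_rw [hterm] at hsum
  have hnonneg : ∀ n : ℕ, 0 ≤ (P * Q).eval (n : ℝ) := by
    intro n
    by_cases hn : n ∈ Set.range k
    · obtain ⟨i, rfl⟩ := hn
      exact (hzero i).ge
    · exact (hpos n hn).le
  rw [hasSum_zero_iff_of_nonneg fun n =>
    mul_nonneg (hnonneg n) (div_nonneg (sq_nonneg _) (normSqH_pos n).le)] at hsum
  refine hF (eq_zero_of_finite_halfInt (a := a) (Finset.univ.image k) fun n hn => ?_)
  have hn' : n ∉ Set.range k := by simpa using hn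
  have h := congrFun hsum n
  rcases mul_eq_zero.mp h with h | h
  · exact absurd h (hpos n hn').ne'
  · exact pow_eq_zero_iff two_ne_zero |>.mp ((div_eq_zero_iff.mp h).resolve_right
      (normSqH_pos n).ne')

theorem seqWr_double_eval_ne_zero (l : ℕ) (lam : Fin l → ℕ) (hlam : Monotone lam) (x : ℝ) :
    (seqWr (gapSeq (double lam))).eval x ≠ 0 := by
  refine seqWr_eval_ne_zero_of_pairing (strictMono_gapSeq (monotone_double hlam)).injective
    -- The gap sequence consists of the pairs `m, m + 1` with `m = lam i + 2 i`; there is no natural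
    -- number between `m` and `m + 1`, hence the positivity elsewhere.
    (P := ∏ i : Fin l, (X - C ((lam i + 2 * i : ℕ) : ℝ)))
    (Q := ∏ i : Fin l, (X - C ((lam i + 2 * i + 1 : ℕ) : ℝ))) ?_ ?_ ?_ ?_ x
  · rw [natDegree_finsetProd_X_sub_C_eq_card]; simp
  · rw [natDegree_finsetProd_X_sub_C_eq_card]; simp
  · intro j
    rw [← Finset.prod_mul_distrib, eval_prod]
    refine Finset.prod_eq_zero (Finset.mem_univ ⟨(j : ℕ) / 2, by omega⟩) ?_
    have hj : (j : ℕ) = 2 * ((j : ℕ) / 2) ∨ (j : ℕ) = 2 * ((j : ℕ) / 2) + 1 := by omega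
    have hg : gapSeq (double lam) j = lam ⟨(j : ℕ) / 2, by omega⟩ + j := rfl
    simp only [eval_mul, eval_sub, eval_X, eval_C, mul_eq_zero, sub_eq_zero, Nat.cast_inj, hg]
    omega
  · intro n hn
    rw [← Finset.prod_mul_distrib, eval_prod]
    refine Finset.prod_pos fun i _ => ?_
    have h1 : n ≠ lam i + 2 * i := by
      rintro rfl
      refine hn ⟨⟨2 * i, by omega⟩, ?_⟩
      have : (⟨2 * (i : ℕ) / 2, by omega⟩ : Fin l) = i := Fin.ext (by simp)
      change lam ⟨2 * (i : ℕ) / 2, _⟩ + 2 * (i : ℕ) = _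
      rw [this]
    have h2 : n ≠ lam i + 2 * i + 1 := by
      rintro rfl
      refine hn ⟨⟨2 * i + 1, by omega⟩, ?_⟩
      have : (⟨(2 * (i : ℕ) + 1) / 2, by omega⟩ : Fin l) = i := Fin.ext (by simp only; omega)
      change lam ⟨(2 * (i : ℕ) + 1) / 2, _⟩ + (2 * (i : ℕ) + 1) = _
      rw [this]
      ring
    simp only [eval_mul, eval_sub, eval_X, eval_C]
    rcases lt_or_gt_of_ne h1 with h | h
    · have h3 : (n : ℝ) < (lam i + 2 * i : ℕ) := by exact_mod_cast h
      have h4 : (n : ℝ) < (lam i + 2 * i + 1 : ℕ) := by exact_mod_cast h.trans (Nat.lt_succ_self _)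
      exact mul_pos_of_neg_of_neg (by linarith) (by linarith)
    · have h3 : ((lam i + 2 * i : ℕ) : ℝ) < n := by exact_mod_cast h
      have h4 : ((lam i + 2 * i + 1 : ℕ) : ℝ) < n := by
        exact_mod_cast lt_of_le_of_ne h h2.symm
      exact mul_pos (by linarith) (by linarith)

/-! ### Orthogonality -/

/-- Each part of the partition contributes, through its pair of gaps, one factor
`4 (j - u) (j - v)`. No condition on `i` and `j` is needed: if one of them is in the gap
sequence, both sides vanish. -/
theorem integral_seqWr_double (l : ℕ) (lam : Fin l → ℕ) (hlam : Monotone lam) (i j : ℕ) :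
    ∫ x : ℝ, (seqWr (snocN (gapSeq (double lam)) i) *
          seqWr (snocN (gapSeq (double lam)) j)).eval x /
        (seqWr (gapSeq (double lam)) ^ 2).eval x * Real.exp (-x ^ 2) =
      if i = j then √Real.pi * 2 ^ (j + 2 * l) * (Nat.factorial j : ℝ) *
        (gapPoly (double lam)).eval (j : ℝ) else 0 := by
  induction l with
  | zero =>
    have h : ∀ k : Fin (2 * 0) → ℕ, ∫ x : ℝ, (seqWr (snocN k i) * seqWr (snocN k j)).eval x /
        (seqWr k ^ 2).eval x * Real.exp (-x ^ 2) = ∫ x : ℝ, (hermiteH i * hermiteH j).eval x *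
          Real.exp (-x ^ 2) := fun k => by
      simp [show seqWr k = 1 from seqWr_empty k, show ∀ a, seqWr (snocN k a) = hermiteH a from
        seqWr_snocN_empty k]
    rw [h, integral_hermiteH_mul_hermiteH]
    simp [gapPoly]
  | succ l ih =>
    have hmono : Monotone fun i : Fin l => lam i.castSucc :=
      fun a b hab => hlam (Fin.castSucc_le_castSucc_iff.mpr hab)
    have hx := seqWr_double_eval_ne_zero _ lam hlam
    have hinj := (strictMono_gapSeq (monotone_double hlam)).injective
    have hpoly : (gapPoly (double lam)).eval (j : ℝ) =
        ((j : ℝ) - (lam (Fin.last l) + 2 * l + 1 : ℕ)) *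
          ((j : ℝ) - (lam (Fin.last l) + 2 * l : ℕ)) *
          (gapPoly (double fun i : Fin l => lam i.castSucc)).eval (j : ℝ) := by
      simp only [gapPoly, eval_prod, eval_sub, eval_X, eval_C]
      rw [gapSeq_double_succ]
      change ∏ a : Fin (2 * l + 1 + 1), _ = _
      rw [Fin.prod_univ_castSucc, Fin.prod_univ_castSucc]
      simp only [snocN_castSucc, snocN_last]
      ring
    rw [hpoly]
    rw [gapSeq_double_succ] at hx hinj ⊢
    change Function.Injective (snocN (snocN _ _) _ : Fin (2 * l + 1 + 1) → ℕ) at hinj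
    refine (integral_seqWr_two_step (injective_of_injective_snocN hinj)
      (seqWr_double_eval_ne_zero _ _ hmono) hx i j).trans ?_
    rw [ih _ hmono]
    split_ifs with hij
    · subst hij
      ring
    · simp

theorem xHermite_eq {l : ℕ} (lam : Fin l → ℕ) (j : ℕ) :
    xHermite lam j = seqWr (snocN (gapSeq (double lam)) j) := by
  rw [seqWr, hermiteH_snocN]
  rfl

end XHermite

end

theorem mainTheorem4 (l : ℕ) (lam : Fin l → ℕ) (hlam : Monotone lam) :
    (∀ x : ℝ, (XHermite.hermiteWr (XHermite.double lam)).eval x ≠ 0) ∧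
    ∀ i ∈ XHermite.indexSet lam, ∀ j ∈ XHermite.indexSet lam,
      Integrable (fun x : ℝ => (XHermite.xHermite lam i).eval x *
        (XHermite.xHermite lam j).eval x * XHermite.weight (XHermite.double lam) x) ∧
      ∫ x : ℝ, (XHermite.xHermite lam i).eval x *
        (XHermite.xHermite lam j).eval x * XHermite.weight (XHermite.double lam) x =
        if i = j then
          Real.sqrt Real.pi * 2 ^ (j + 2 * l) * (Nat.factorial j : ℝ) *
            (XHermite.gapPoly (XHermite.double lam)).eval (j : ℝ)
        else 0 := by
  have hne := XHermite.seqWr_double_eval_ne_zero l lam hlam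
  refine ⟨hne, fun i _ j _ => ?_⟩
  have hfun : (fun x : ℝ => (XHermite.xHermite lam i).eval x *
      (XHermite.xHermite lam j).eval x * XHermite.weight (XHermite.double lam) x) = fun x : ℝ =>
      (XHermite.seqWr (XHermite.snocN (XHermite.gapSeq (XHermite.double lam)) i) *
        XHermite.seqWr (XHermite.snocN (XHermite.gapSeq (XHermite.double lam)) j)).eval x /
        (XHermite.seqWr (XHermite.gapSeq (XHermite.double lam)) ^ 2).eval x *
          Real.exp (-x ^ 2) := by
    ext1 x
    rw [XHermite.xHermite_eq, XHermite.xHermite_eq, XHermite.weight, eval_mul, eval_pow,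
      show XHermite.hermiteWr (XHermite.double lam) =
        XHermite.seqWr (XHermite.gapSeq (XHermite.double lam)) from rfl]
    ring
  rw [hfun]
  exact ⟨XHermite.integrable_div_mul_exp _ fun x => by
      rw [eval_pow]; exact pow_ne_zero 2 (hne x),
    XHermite.integral_seqWr_double l lam hlam i j⟩
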